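/- Let $b_n(x)$ ($n\ge 0$) be the Bernoulli polynomials of the second kind, defined by $$\sum_{n=0}^{\infty}\frac{b_n(x)}{n!}t^n=\frac{t(1+t)^x}{\ln(1+t)},$$ and let $b_n=b_n(0)$ be the Bernoulli numbers of the second kind. For integers $0\le m<n$ put $$S_{m,n}=\sum_{k=0}^{n-m-1}\ \sum_{m=i_0<i_1<\cdots<i_{k+1}=n}\ \prod_{j=0}^{k}\bigl((i_{j+1}-i_j-1)!\bigr)^2\binom{i_{j+1}}{i_j+1}\binom{i_{j+1}+1}{i_j},$$ where the inner sum is over chains of integers. Let $c_{n,n}=n!$ for $n\ge 0$, and $$c_{n,m}=\frac{(-1)^{n-m}\,m!\,(m+1)!}{(n+1)!}\,S_{m,n}\qquad(0\le m<n).$$ Then for every $n\ge 0$, as polynomials in $x$, $$b_n(x)=\sum_{m=0}^{n}c_{n,m}\binom{x+1}{m}.$$ Moreover, for every $n\ge 2$, $b_n=c_{n,0}+c_{n,1}$, that is, $$b_n=\frac{(-1)^n}{(n+1)!}\,S_{0,n}+\frac{(-1)^{n-1}\cdot 2}{(n+1)!}\,S_{1,n}.$$ -/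

import Mathlib

open Polynomial
open scoped Nat PowerSeries

noncomputable section

/-- The formal power series `ln(1+t)/t` in the variable `t`, with coefficients in `ℚ[X]`. -/
def logOneAddDiv : ℚ[X]⟦X⟧ :=
  PowerSeries.mk fun k => PowerSeries.coeff (k + 1) (PowerSeries.log ℚ[X])

theorem X_mul_logOneAddDiv : PowerSeries.X * logOneAddDiv = PowerSeries.log ℚ[X] := by
  ext1 n
  cases n with
  | zero => simp
  | succ n => rw [PowerSeries.coeff_succ_X_mul, logOneAddDiv, PowerSeries.coeff_mk]

/-- The generating function `t(1+t)^x / ln(1+t)`, a formal power series in `t` whose coefficients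
are polynomials in `x`; the series `ln(1+t)/t` has constant term `1` and is inverted as a
power series. -/
def bernoulliSecondGenFun : ℚ[X]⟦X⟧ :=
  PowerSeries.invOfUnit logOneAddDiv 1 * PowerSeries.binomialSeries ℚ[X] (X : ℚ[X])

/-- The defining property of the generating function: multiplied by `ln(1+t)` it is
`t(1+t)^x`. -/
theorem bernoulliSecondGenFun_mul_log :
    bernoulliSecondGenFun * PowerSeries.log ℚ[X] =
      PowerSeries.X * PowerSeries.binomialSeries ℚ[X] (X : ℚ[X]) := by
  have h : logOneAddDiv * PowerSeries.invOfUnit logOneAddDiv 1 = 1 := by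
    apply PowerSeries.mul_invOfUnit
    rw [← PowerSeries.coeff_zero_eq_constantCoeff_apply, logOneAddDiv, PowerSeries.coeff_mk,
      PowerSeries.coeff_one_log, Units.val_one]
  rw [bernoulliSecondGenFun, ← X_mul_logOneAddDiv]
  linear_combination (PowerSeries.X * PowerSeries.binomialSeries ℚ[X] (X : ℚ[X])) * h

/-- The Bernoulli polynomial of the second kind `b_n(x)`, in the normalization
`∑ b_n(x) t^n / n! = t(1+t)^x / ln(1+t)`. -/
def bernoulliSecondPoly (n : ℕ) : ℚ[X] :=
  (n ! : ℚ) • PowerSeries.coeff n bernoulliSecondGenFun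

/-- The Bernoulli number of the second kind `b_n = b_n(0)`. -/
def bernoulliSecond (n : ℕ) : ℚ :=
  (bernoulliSecondPoly n).eval 0

/-- The chains `m = i_0 < i_1 < ⋯ < i_{k+1} = n` of integers. -/
def chains (m n k : ℕ) : Finset (Fin (k + 2) → ℕ) :=
  open scoped Classical in
  (Fintype.piFinset fun _ => Finset.Icc m n).filter fun i =>
    StrictMono i ∧ i 0 = m ∧ i (Fin.last (k + 1)) = n

theorem mem_chains {m n k : ℕ} {i : Fin (k + 2) → ℕ} :
    i ∈ chains m n k ↔ StrictMono i ∧ i 0 = m ∧ i (Fin.last (k + 1)) = n := by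
  classical
  simp only [chains, Finset.mem_filter, Fintype.mem_piFinset, Finset.mem_Icc,
    and_iff_right_iff_imp]
  rintro ⟨hi, rfl, rfl⟩ j
  exact ⟨hi.monotone (Fin.zero_le j), hi.monotone (Fin.le_last j)⟩

/-- The chain sum (for `m < n`)
`∑_{k=0}^{n-m-1} ∑_{m = i_0 < ⋯ < i_{k+1} = n} ∏_{j=0}^{k}
  (i_{j+1} - i_j - 1)!² * binom(i_{j+1}, i_j + 1) * binom(i_{j+1} + 1, i_j)`.
As chains are strictly increasing, no subtraction is truncated. -/
def chainSum (m n : ℕ) : ℕ :=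
  ∑ k ∈ Finset.range (n - m), ∑ i ∈ chains m n k, ∏ j : Fin (k + 1),
    (i j.succ - i j.castSucc - 1)! ^ 2 *
      (i j.succ).choose (i j.castSucc + 1) * (i j.succ + 1).choose (i j.castSucc)

/-- The coefficients `c_{n,m}`, used for `m ≤ n`. -/
def bernoulliSecondCoeff (n m : ℕ) : ℚ :=
  if m = n then (n ! : ℚ)
  else (-1) ^ (n - m) * (m ! : ℚ) * ((m + 1)! : ℚ) / ((n + 1)! : ℚ) * (chainSum m n : ℚ)

end

/-!
For `i < j` with `d = j - i`, the weight of the step from `i` to `j` in `chainSum` equals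
`j! (j + 1)! / (i! (i + 1)!) * 1 / (d (d + 1))` (`stepWeight_cast`). Along a chain from `m` to `n`
the factorials telescope, and recording a chain by its gaps turns the sum over chains into the sum
over the compositions of `n - m` of the product of `1 / (d (d + 1))` over the parts `d`. Hence, up
to the factorials, `chainSum m n` is the coefficient of `u ^ (n - m)` in `1 / (1 - P(u))` with
`P(u) = ∑_{d ≥ 1} u ^ d / (d (d + 1))` (`chainSum_cast`). The proof is by induction on `n - m`:
removing the first step of a chain gives the recurrence `chainSum_eq_add_sum`, which matches the
one obtained by comparing coefficients in `1 / (1 - P) = 1 + P * (1 / (1 - P))`.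

On the other side, `1 - P(-t) = (1 + t) ln(1 + t) / t` by partial fractions
(`evalNegHom_one_sub_stepSeries`), so that the generating function of the Bernoulli polynomials of
the second kind is the product of `1 / (1 - P(-t))`, whose coefficients are constants, and
`(1 + t) ^ (x + 1) = ∑ binom(x + 1, m) t ^ m` (`bernoulliSecondGenFun_eq`). Reading off the
coefficient of `t ^ n` gives the expansion of `b_n(x)`, and at `x = 0` only the terms with `m ≤ 1`
remain.
-/

open Finset

/-! ### Sums over chains -/

/-- The sum over the chains `m = i_0 < ⋯ < i_{k+1} = n` with exactly `k` interior points of the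
product of the weights `w i_j i_{j+1}` of the steps. -/
def chainWeight (w : ℕ → ℕ → ℕ) (m n k : ℕ) : ℕ :=
  ∑ i ∈ chains m n k, ∏ j : Fin (k + 1), w (i j.castSucc) (i j.succ)

theorem chainWeight_zero (w : ℕ → ℕ → ℕ) {m n : ℕ} (h : m < n) :
    chainWeight w m n 0 = w m n := by
  have hc : chains m n 0 = {![m, n]} := by
    ext i
    rw [mem_chains, Finset.mem_singleton]
    constructor
    · rintro ⟨-, h0, h1⟩
      ext j
      fin_cases j
      · exact h0
      · exact h1
    · rintro rfl
      exact ⟨by simp [h], rfl, rfl⟩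
  simp [chainWeight, hc]

theorem chainWeight_succ (w : ℕ → ℕ → ℕ) (m n k : ℕ) :
    chainWeight w m n (k + 1) = ∑ l ∈ Ioo m n, w m l * chainWeight w l n k := by
  simp only [chainWeight, Finset.mul_sum, Finset.sum_sigma']
  refine Finset.sum_bij' (fun i _ => ⟨i 1, Fin.tail i⟩) (fun p _ => Matrix.vecCons m p.2)
    ?_ ?_ ?_ ?_ ?_
  · intro i hi
    obtain ⟨hs, h0, hl⟩ := mem_chains.1 hi
    simp only [Finset.mem_sigma, Finset.mem_Ioo, mem_chains]
    refine ⟨⟨h0 ▸ hs Fin.zero_lt_one, hl ▸ hs ?_⟩, ?_, rfl, hl⟩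
    · rw [Fin.lt_def]
      simp
    · exact hs.comp (Fin.strictMono_succ)
  · rintro ⟨l, i⟩ hi
    simp only [Finset.mem_sigma, Finset.mem_Ioo, mem_chains] at hi
    obtain ⟨⟨hml, -⟩, hs, h0, hl⟩ := hi
    exact mem_chains.2 ⟨strictMono_vecCons.2 ⟨h0 ▸ hml, hs⟩, rfl, hl⟩
  · intro i hi
    obtain ⟨-, h0, -⟩ := mem_chains.1 hi
    change Fin.cons m (Fin.tail i) = i
    rw [← h0, Fin.cons_self_tail]
  · rintro ⟨l, i⟩ hi
    simp only [Finset.mem_sigma, mem_chains] at hi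
    obtain ⟨-, -, rfl, -⟩ := hi
    rfl
  · intro i hi
    obtain ⟨-, h0, -⟩ := mem_chains.1 hi
    rw [Fin.prod_univ_succ, ← h0]
    rfl

theorem chainWeight_eq_zero (w : ℕ → ℕ → ℕ) {m n k : ℕ} (h : n ≤ m + k) :
    chainWeight w m n k = 0 := by
  induction k generalizing m with
  | zero =>
    refine Finset.sum_eq_zero fun i hi => ?_
    obtain ⟨hs, h0, hl⟩ := mem_chains.1 hi
    have := hs (Fin.zero_lt_one (n := 0))
    change i 1 = n at hl
    omega
  | succ k ih =>
    rw [chainWeight_succ]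
    refine Finset.sum_eq_zero fun l hl => ?_
    rw [Finset.mem_Ioo] at hl
    rw [ih (by omega), mul_zero]

/-- The weight of a single step in `chainSum`. -/
def stepWeight (i j : ℕ) : ℕ :=
  (j - i - 1)! ^ 2 * j.choose (i + 1) * (j + 1).choose i

theorem chainSum_eq_sum_chainWeight {m n N : ℕ} (h : n ≤ m + N) :
    chainSum m n = ∑ k ∈ range N, chainWeight stepWeight m n k := by
  refine Finset.sum_subset (by simp only [range_subset_range]; omega) fun k _ hk => ?_
  rw [Finset.mem_range] at hk
  exact chainWeight_eq_zero stepWeight (by omega)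

/-- Splitting the chains according to their first step. -/
theorem chainSum_eq_add_sum {m n : ℕ} (h : m < n) :
    chainSum m n = stepWeight m n + ∑ l ∈ Ioo m n, stepWeight m l * chainSum l n := by
  obtain ⟨N, rfl⟩ := Nat.exists_eq_add_of_lt h
  rw [chainSum_eq_sum_chainWeight (N := N + 1) (by omega), Finset.sum_range_succ',
    chainWeight_zero _ h, add_comm]
  simp only [chainWeight_succ]
  rw [Finset.sum_comm]
  congr 1
  refine Finset.sum_congr rfl fun l hl => ?_
  rw [Finset.mem_Ioo] at hl
  rw [chainSum_eq_sum_chainWeight (N := N) (by omega), Finset.mul_sum]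

theorem stepWeight_cast {i j : ℕ} (h : i < j) :
    (stepWeight i j : ℚ) = ((j ! : ℚ) * (j + 1)! / (i ! * (i + 1)!)) *
      (1 / ((j - i : ℕ) * ((j - i : ℕ) + 1))) := by
  obtain ⟨d, rfl⟩ := Nat.exists_eq_add_of_lt h
  have h1 : i + d + 1 - i - 1 = d := by omega
  have h2 : i + d + 1 - i = d + 1 := by omega
  have h3 : i + d + 1 - (i + 1) = d := by omega
  have h4 : i + d + 1 + 1 - i = d + 2 := by omega
  rw [stepWeight, h1, h2]
  push_cast
  rw [Nat.cast_choose ℚ (by omega : i + 1 ≤ i + d + 1),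
    Nat.cast_choose ℚ (by omega : i ≤ i + d + 1 + 1), h3, h4]
  have hd : (d ! : ℚ) ≠ 0 := by positivity
  have hi : (i ! : ℚ) ≠ 0 := by positivity
  rw [Nat.factorial_succ (d + 1), Nat.factorial_succ d, Nat.factorial_succ i]
  push_cast
  field_simp

/-! ### The power series of a single step -/

/-- The series `∑_{d ≥ 1} u ^ d / (d (d + 1))`; division by zero makes the term `d = 0` vanish. -/
def stepSeries : ℚ⟦X⟧ :=
  PowerSeries.mk fun d => 1 / ((d : ℚ) * (d + 1))

theorem coeff_stepSeries (d : ℕ) :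
    PowerSeries.coeff d stepSeries = 1 / ((d : ℚ) * (d + 1)) :=
  PowerSeries.coeff_mk _ _

/-- The generating series `1 / (1 - stepSeries)` of compositions, each part `d` having weight
`1 / (d (d + 1))`. -/
noncomputable def compositionSeries : ℚ⟦X⟧ :=
  (1 - stepSeries)⁻¹

theorem constantCoeff_stepSeries : PowerSeries.constantCoeff stepSeries = 0 := by
  rw [← PowerSeries.coeff_zero_eq_constantCoeff_apply, coeff_stepSeries]
  simp

theorem one_sub_stepSeries_mul_compositionSeries :
    (1 - stepSeries) * compositionSeries = 1 := by
  refine PowerSeries.mul_inv_cancel _ ?_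
  simp [constantCoeff_stepSeries]

theorem coeff_zero_compositionSeries : PowerSeries.coeff 0 compositionSeries = 1 := by
  have h := congrArg (PowerSeries.coeff 0) one_sub_stepSeries_mul_compositionSeries
  simpa [constantCoeff_stepSeries] using h

theorem coeff_compositionSeries {d : ℕ} (hd : d ≠ 0) :
    PowerSeries.coeff d compositionSeries =
      ∑ e ∈ range (d + 1), 1 / ((e : ℚ) * (e + 1)) *
        PowerSeries.coeff (d - e) compositionSeries := by
  have h : compositionSeries = 1 + stepSeries * compositionSeries := by
    linear_combination one_sub_stepSeries_mul_compositionSeries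
  conv_lhs => rw [h]
  rw [map_add, PowerSeries.coeff_one, if_neg hd, zero_add, PowerSeries.coeff_mul,
    Finset.Nat.sum_antidiagonal_eq_sum_range_succ
      (fun a b => PowerSeries.coeff a stepSeries * PowerSeries.coeff b compositionSeries)]
  simp only [coeff_stepSeries]

/-- The factorials in the step weights telescope along a chain, and the chains from `m` to `n`
correspond to the compositions of `n - m`. -/
theorem chainSum_cast {m n : ℕ} (h : m < n) :
    (chainSum m n : ℚ) = ((n ! : ℚ) * (n + 1)! / (m ! * (m + 1)!)) *
      PowerSeries.coeff (n - m) compositionSeries := by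
  induction hd : n - m using Nat.strong_induction_on generalizing m with
  | _ d ih =>
    subst hd
    have hsum : PowerSeries.coeff (n - m) compositionSeries =
        (∑ l ∈ Ioo m n, 1 / (((l - m : ℕ) : ℚ) * ((l - m : ℕ) + 1)) *
          PowerSeries.coeff (n - l) compositionSeries) +
          1 / (((n - m : ℕ) : ℚ) * ((n - m : ℕ) + 1)) := by
      rw [coeff_compositionSeries (by omega), Finset.sum_range_succ, Nat.sub_self,
        coeff_zero_compositionSeries, mul_one]
      congr 1
      -- The term `e = 0` is zero, and the others are indexed by `l = m + e`.
      rw [Finset.range_eq_Ico, Finset.sum_eq_sum_Ico_succ_bot (by omega)]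
      simp only [Nat.cast_zero, zero_mul, div_zero, zero_add]
      have hI : Ioo m n = Ico (1 + m) (n - m + m) := by
        ext l
        simp only [Finset.mem_Ioo, Finset.mem_Ico]
        omega
      rw [hI, ← Finset.sum_Ico_add']
      refine Finset.sum_congr rfl fun e _ => ?_
      rw [Nat.add_sub_cancel, Nat.sub_sub, Nat.add_comm e m]
    rw [chainSum_eq_add_sum h, hsum, Nat.cast_add, Nat.cast_sum, stepWeight_cast h,
      add_comm, mul_add _ (∑ l ∈ Ioo m n, _), Finset.mul_sum]
    congr 1
    refine Finset.sum_congr rfl fun l hl => ?_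
    rw [Finset.mem_Ioo] at hl
    rw [Nat.cast_mul, stepWeight_cast hl.1, ih (n - l) (by omega) hl.2 rfl]
    have h1 : (l ! : ℚ) ≠ 0 := by positivity
    have h2 : ((l + 1)! : ℚ) ≠ 0 := by positivity
    field_simp

theorem bernoulliSecondCoeff_eq {m n : ℕ} (h : m ≤ n) :
    bernoulliSecondCoeff n m =
      n ! * ((-1) ^ (n - m) * PowerSeries.coeff (n - m) compositionSeries) := by
  rcases h.eq_or_lt with rfl | h
  · simp [bernoulliSecondCoeff, -PowerSeries.coeff_zero_eq_constantCoeff,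
      coeff_zero_compositionSeries]
  · rw [bernoulliSecondCoeff, if_neg h.ne, chainSum_cast h]
    have h1 : ((m + 1)! : ℚ) ≠ 0 := by positivity
    have h2 : ((n + 1)! : ℚ) ≠ 0 := by positivity
    have h3 : (m ! : ℚ) ≠ 0 := by positivity
    field_simp

/-! ### The generating function in the basis of binomial coefficients -/

/-- The formal identity `1 - ∑_{d ≥ 1} (-t) ^ d / (d (d + 1)) = (1 + t) ln(1 + t) / t`. -/
theorem evalNegHom_one_sub_stepSeries :
    PowerSeries.map (C : ℚ →+* ℚ[X]) (PowerSeries.evalNegHom (1 - stepSeries)) =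
      (1 + PowerSeries.X) * logOneAddDiv := by
  ext1 d
  rw [PowerSeries.coeff_map, PowerSeries.evalNegHom, PowerSeries.coeff_rescale, map_sub,
    coeff_stepSeries, add_mul, one_mul, map_add]
  cases d with
  | zero => simp [logOneAddDiv]
  | succ d =>
    rw [PowerSeries.coeff_succ_X_mul, logOneAddDiv, PowerSeries.coeff_mk, PowerSeries.coeff_mk,
      PowerSeries.coeff_log, PowerSeries.coeff_log, if_neg (by omega), if_neg (by omega),
      PowerSeries.coeff_one, if_neg (by omega), ← map_add, Polynomial.algebraMap_eq]
    congr 1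
    push_cast
    have h1 : (d : ℚ) + 1 ≠ 0 := by positivity
    have h2 : (d : ℚ) + 1 + 1 ≠ 0 := by positivity
    field_simp
    ring

theorem binomialSeries_X_add_one :
    PowerSeries.binomialSeries ℚ[X] (X + 1 : ℚ[X]) =
      (1 + PowerSeries.X) * PowerSeries.binomialSeries ℚ[X] (X : ℚ[X]) := by
  have h := PowerSeries.binomialSeries_nat (R := ℚ[X]) (A := ℚ[X]) 1
  rw [Nat.cast_one, pow_one] at h
  rw [PowerSeries.binomialSeries_add, h, mul_comm]

/-- The factorization `t(1 + t) ^ x / ln(1 + t) = t / ((1 + t) ln(1 + t)) * (1 + t) ^ (x + 1)`. -/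
theorem bernoulliSecondGenFun_eq :
    bernoulliSecondGenFun =
      PowerSeries.map (C : ℚ →+* ℚ[X]) (PowerSeries.evalNegHom compositionSeries) *
        PowerSeries.binomialSeries ℚ[X] (X + 1 : ℚ[X]) := by
  have hG : (1 + PowerSeries.X) * logOneAddDiv *
      PowerSeries.map (C : ℚ →+* ℚ[X]) (PowerSeries.evalNegHom compositionSeries) = 1 := by
    rw [← evalNegHom_one_sub_stepSeries, ← map_mul, ← map_mul,
      one_sub_stepSeries_mul_compositionSeries, map_one, map_one]
  have hF : bernoulliSecondGenFun * logOneAddDiv =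
      PowerSeries.binomialSeries ℚ[X] (X : ℚ[X]) := by
    refine mul_left_cancel₀ (PowerSeries.X_ne_zero (R := ℚ[X])) ?_
    rw [← bernoulliSecondGenFun_mul_log, ← X_mul_logOneAddDiv]
    ring
  rw [binomialSeries_X_add_one, ← hF]
  linear_combination -bernoulliSecondGenFun * hG

theorem bernoulliSecondPoly_eq_sum (n : ℕ) :
    bernoulliSecondPoly n =
      ∑ m ∈ range (n + 1), C (bernoulliSecondCoeff n m) * Ring.choose (X + 1 : ℚ[X]) m := by
  rw [bernoulliSecondPoly, bernoulliSecondGenFun_eq, mul_comm, PowerSeries.coeff_mul,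
    Finset.Nat.sum_antidiagonal_eq_sum_range_succ
      (fun a b => PowerSeries.coeff a (PowerSeries.binomialSeries ℚ[X] (X + 1 : ℚ[X])) *
        PowerSeries.coeff b
          (PowerSeries.map (C : ℚ →+* ℚ[X]) (PowerSeries.evalNegHom compositionSeries))),
    Finset.smul_sum]
  refine Finset.sum_congr rfl fun m hm => ?_
  rw [bernoulliSecondCoeff_eq (Finset.mem_range_succ_iff.1 hm), PowerSeries.binomialSeries_coeff,
    PowerSeries.coeff_map, PowerSeries.evalNegHom, PowerSeries.coeff_rescale,
    Polynomial.smul_eq_C_mul, smul_eq_mul, mul_one]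
  simp only [C_mul]
  ring

theorem eval_zero_choose_X_add_one (m : ℕ) :
    (Ring.choose (X + 1 : ℚ[X]) m).eval 0 = (Nat.choose 1 m : ℚ) := by
  rw [← Polynomial.coe_evalRingHom, Ring.map_choose, ← Ring.choose_natCast]
  simp

/-- At `x = 0` only `binom(1, 0)` and `binom(1, 1)` survive. -/
theorem bernoulliSecond_eq_add {n : ℕ} (hn : 2 ≤ n) :
    bernoulliSecond n = bernoulliSecondCoeff n 0 + bernoulliSecondCoeff n 1 := by
  rw [bernoulliSecond, bernoulliSecondPoly_eq_sum, Polynomial.eval_finsetSum]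
  simp only [Polynomial.eval_mul, Polynomial.eval_C, eval_zero_choose_X_add_one]
  rw [← Finset.sum_subset (Finset.range_subset_range.2 (by omega : 2 ≤ n + 1)),
    Finset.sum_range_succ, Finset.sum_range_one]
  · simp
  · intro m _ hm
    rw [Finset.mem_range, not_lt] at hm
    rw [Nat.choose_eq_zero_of_lt (by omega), Nat.cast_zero, mul_zero]

theorem corollary5p3 :
    (∀ n : ℕ, bernoulliSecondPoly n =
      ∑ m ∈ Finset.range (n + 1),
        Polynomial.C (bernoulliSecondCoeff n m) * Ring.choose (Polynomial.X + 1 : ℚ[X]) m) ∧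
    (∀ n : ℕ, 2 ≤ n →
      bernoulliSecond n = bernoulliSecondCoeff n 0 + bernoulliSecondCoeff n 1 ∧
      bernoulliSecond n =
        (-1) ^ n / ((n + 1)! : ℚ) * (chainSum 0 n : ℚ) +
          (-1) ^ (n - 1) * 2 / ((n + 1)! : ℚ) * (chainSum 1 n : ℚ)) := by
  refine ⟨bernoulliSecondPoly_eq_sum, fun n hn => ⟨bernoulliSecond_eq_add hn, ?_⟩⟩
  rw [bernoulliSecond_eq_add hn, bernoulliSecondCoeff, bernoulliSecondCoeff,
    if_neg (by omega), if_neg (by omega)]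
  simp
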